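/- Let $k$ be a field and $R$ a commutative $k$-algebra. Identify $f\in R$ with the operator $g\mapsto fg$ in $\operatorname{End}_k(R)$, put $D^0_{R|k}=R$ and $D^{n}_{R|k}=\{\xi\in\operatorname{End}_k(R): [\xi,f]\in D^{n-1}_{R|k}\text{ for all } f\in R\}$ for $n\ge 1$, and let $D_{R|k}=\bigcup_{n\ge 0} D^n_{R|k}$ be the ring of $k$-linear differential operators on $R$. Let $\Phi$ be a ring anti-automorphism of $D_{R|k}$ (an additive bijection with $\Phi(1)=1$ and $\Phi(\xi\eta)=\Phi(\eta)\Phi(\xi)$) that fixes $R$, i.e. $\Phi(f)=f$ for all $f\in R$. Then $\Phi$ is involutive, i.e. $\Phi(\Phi(\xi))=\xi$ for all $\xi\in D_{R|k}$, in each of the following cases: (1) $R$ is reduced and essentially of finite type over $k$. (2) $R$ is a zero-dimensional Gorenstein local ring, $k$ is a coefficient field of $R$ (the composite of $k\to R$ with the projection of $R$ onto its residue field is an isomorphism), and $\Phi$ corresponds to the right $D_{R|k}$-module structure on $R$ obtained by pulling back, along some $R$-linear isomorphism $\varphi: R\cong\operatorname{Hom}_k(R,k)$, the right $D_{R|k}$-module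 structure $\psi\cdot\xi=\psi\circ\xi$ on $\operatorname{Hom}_k(R,k)$. Here the $R$-module structure on $\operatorname{Hom}_k(R,k)$ is $(f\psi)(g)=\psi(fg)$, and the right $D_{R|k}$-module structure on $R$ corresponding to $\Phi$ is $f\cdot\xi=\Phi(\xi)(f)$. That is, $\varphi(\Phi(\xi)(f))=\varphi(f)\circ\xi$ for all $\xi\in D_{R|k}$ and $f\in R$. -/

import Mathlib

open MulOpposite

universe u v w

section DifferentialOperators

variable (k : Type u) (R : Type v) [CommRing k] [CommRing R] [Algebra k R]

/-- The `k`-linear differential operators of order at most `n` on `R`: order `0` means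
multiplication by an element of `R`, and `ξ` has order at most `n + 1` when every commutator
`[ξ, f]`, `f ∈ R`, has order at most `n`. -/
def diffOpLE : ℕ → Submodule k (Module.End k R)
  | 0 => LinearMap.range (Algebra.lmul k R).toLinearMap
  | n + 1 =>
    { carrier := {ξ | ∀ f : R, ξ * Algebra.lmul k R f - Algebra.lmul k R f * ξ ∈ diffOpLE n}
      zero_mem' := fun f => by simp
      add_mem' := fun {a b} ha hb f => by
        have h := (diffOpLE n).add_mem (ha f) (hb f)
        have e : (a + b) * Algebra.lmul k R f - Algebra.lmul k R f * (a + b) =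
            (a * Algebra.lmul k R f - Algebra.lmul k R f * a) +
              (b * Algebra.lmul k R f - Algebra.lmul k R f * b) := by noncomm_ring
        rw [e]; exact h
      smul_mem' := fun c a ha f => by
        have h := (diffOpLE n).smul_mem c (ha f)
        rw [smul_mul_assoc, mul_smul_comm, ← smul_sub]; exact h }

variable {k R}

theorem mem_diffOpLE_zero {ξ : Module.End k R} :
    ξ ∈ diffOpLE k R 0 ↔ ∃ f : R, Algebra.lmul k R f = ξ := Iff.rfl

theorem mem_diffOpLE_succ {n : ℕ} {ξ : Module.End k R} :
    ξ ∈ diffOpLE k R (n + 1) ↔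
      ∀ f : R, ξ * Algebra.lmul k R f - Algebra.lmul k R f * ξ ∈ diffOpLE k R n := Iff.rfl

theorem diffOpLE_le_succ (n : ℕ) : diffOpLE k R n ≤ diffOpLE k R (n + 1) := by
  induction n with
  | zero =>
    rintro _ ⟨g, rfl⟩ f
    have e : (Algebra.lmul k R).toLinearMap g * Algebra.lmul k R f -
        Algebra.lmul k R f * (Algebra.lmul k R).toLinearMap g = 0 := by
      rw [AlgHom.toLinearMap_apply, ← map_mul, ← map_mul, mul_comm, sub_self]
    rw [e]; exact Submodule.zero_mem _
  | succ n ih => exact fun ξ hξ f => ih (hξ f)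

theorem diffOpLE_mono : Monotone (diffOpLE k R) := monotone_nat_of_le_succ diffOpLE_le_succ

theorem diffOpLE_mul (N : ℕ) : ∀ (m n : ℕ), m + n = N → ∀ ξ ∈ diffOpLE k R m,
    ∀ η ∈ diffOpLE k R n, ξ * η ∈ diffOpLE k R N := by
  induction N with
  | zero =>
    intro m n h ξ hξ η hη
    obtain ⟨rfl, rfl⟩ : m = 0 ∧ n = 0 := by omega
    obtain ⟨f, rfl⟩ := hξ
    obtain ⟨g, rfl⟩ := hη
    exact ⟨f * g, map_mul (Algebra.lmul k R) f g⟩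
  | succ N ih =>
    intro m n h ξ hξ η hη f
    have key : ξ * η * Algebra.lmul k R f - Algebra.lmul k R f * (ξ * η) =
        ξ * (η * Algebra.lmul k R f - Algebra.lmul k R f * η) +
          (ξ * Algebra.lmul k R f - Algebra.lmul k R f * ξ) * η := by
      rw [mul_sub, sub_mul]; simp only [mul_assoc]; abel
    rw [key]
    refine Submodule.add_mem _ ?_ ?_
    · cases n with
      | zero =>
        obtain ⟨g, rfl⟩ := hη
        have e : (Algebra.lmul k R).toLinearMap g * Algebra.lmul k R f -
            Algebra.lmul k R f * (Algebra.lmul k R).toLinearMap g = 0 := by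
          rw [AlgHom.toLinearMap_apply, ← map_mul, ← map_mul, mul_comm, sub_self]
        rw [e, mul_zero]; exact Submodule.zero_mem _
      | succ n => exact ih m n (by omega) ξ hξ _ (hη f)
    · cases m with
      | zero =>
        obtain ⟨g, rfl⟩ := hξ
        have e : (Algebra.lmul k R).toLinearMap g * Algebra.lmul k R f -
            Algebra.lmul k R f * (Algebra.lmul k R).toLinearMap g = 0 := by
          rw [AlgHom.toLinearMap_apply, ← map_mul, ← map_mul, mul_comm, sub_self]
        rw [e, zero_mul]; exact Submodule.zero_mem _
      | succ m => exact ih m n (by omega) _ (hξ f) η hη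

variable (k R)

/-- The ring `D_{R|k}` of `k`-linear differential operators on `R`, as a subring (in fact a
`k`-subalgebra) of `End_k(R)`. -/
def DiffOp : Subalgebra k (Module.End k R) where
  carrier := {ξ | ∃ n, ξ ∈ diffOpLE k R n}
  mul_mem' := by
    rintro ξ η ⟨m, hm⟩ ⟨n, hn⟩
    exact ⟨m + n, diffOpLE_mul _ m n rfl ξ hm η hn⟩
  add_mem' := by
    rintro ξ η ⟨m, hm⟩ ⟨n, hn⟩
    exact ⟨max m n, Submodule.add_mem _ (diffOpLE_mono (le_max_left m n) hm)
      (diffOpLE_mono (le_max_right m n) hn)⟩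
  algebraMap_mem' := fun c => ⟨0, algebraMap k R c, (Algebra.lmul k R).commutes c⟩

/-- The inclusion `R → D_{R|k}` sending `f` to the operator `g ↦ f * g`. -/
def mulOp : R →ₐ[k] DiffOp k R :=
  (Algebra.lmul k R).codRestrict (DiffOp k R) (fun f => ⟨0, f, rfl⟩)

variable {k R}

/-- An anti-automorphism `Φ` of `D_{R|k}` (an isomorphism onto the opposite ring) fixes `R`. -/
def FixesBase (Φ : DiffOp k R ≃+* (DiffOp k R)ᵐᵒᵖ) : Prop :=
  ∀ f : R, Φ (mulOp k R f) = op (mulOp k R f)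

/-- An anti-automorphism `Φ` of `D_{R|k}` is involutive: it is its own inverse. -/
def IsInvolutive (Φ : DiffOp k R ≃+* (DiffOp k R)ᵐᵒᵖ) : Prop :=
  Function.Involutive fun ξ : DiffOp k R => unop (Φ ξ)

variable (k R)

/-- A compatible right `D_{R|k}`-module structure on an `R`-module `M`: a right module structure
(that is, a module structure over the opposite ring) which extends the given `R`-module
structure. -/
structure CompatibleRightModule (M : Type w) [AddCommGroup M] [Module R M]
    extends Module (DiffOp k R)ᵐᵒᵖ M where
  compat : ∀ (f : R) (x : M), op (mulOp k R f) • x = f • x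

variable {k R}

/-- Pull back a compatible right `D_{R|k}`-module structure along an `R`-linear isomorphism `e`:
`x · ξ = e⁻¹ (e x · ξ)`. -/
def CompatibleRightModule.pullback {M N : Type*} [AddCommGroup M] [Module R M]
    [AddCommGroup N] [Module R N] (S : CompatibleRightModule k R N) (e : M ≃ₗ[R] N) :
    CompatibleRightModule k R M :=
  letI := S.toModule
  { smul := fun ξ x => e.symm (ξ • e x)
    one_smul := fun x => show e.symm ((1 : (DiffOp k R)ᵐᵒᵖ) • e x) = x by
      rw [one_smul, e.symm_apply_apply]
    mul_smul := fun ξ η x =>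
      show e.symm ((ξ * η) • e x) = e.symm (ξ • e (e.symm (η • e x))) by
        rw [e.apply_symm_apply, mul_smul]
    smul_zero := fun ξ => show e.symm (ξ • e 0) = 0 by rw [map_zero, smul_zero, map_zero]
    smul_add := fun ξ x y =>
      show e.symm (ξ • e (x + y)) = e.symm (ξ • e x) + e.symm (ξ • e y) by
        rw [map_add, smul_add, map_add]
    add_smul := fun ξ η x =>
      show e.symm ((ξ + η) • e x) = e.symm (ξ • e x) + e.symm (η • e x) by
        rw [add_smul, map_add]
    zero_smul := fun x => show e.symm ((0 : (DiffOp k R)ᵐᵒᵖ) • e x) = 0 by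
      rw [zero_smul, map_zero]
    compat := fun f x => show e.symm (op (mulOp k R f) • e x) = f • x by
      rw [S.compat, map_smul, e.symm_apply_apply] }

/-- The compatible right `D_{R|k}`-module structure on `R` that corresponds to an
anti-automorphism `Φ` of `D_{R|k}` fixing `R`, namely `f · ξ = Φ(ξ)(f)`. -/
def CompatibleRightModule.ofAntiAut (Φ : DiffOp k R ≃+* (DiffOp k R)ᵐᵒᵖ) (hΦ : FixesBase Φ) :
    CompatibleRightModule k R R where
  smul ξ f := (unop (Φ (unop ξ))).1 f
  one_smul f := show (unop (Φ (unop 1))).1 f = f by simp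
  mul_smul ξ η f := show (unop (Φ (unop (ξ * η)))).1 f =
      (unop (Φ (unop ξ))).1 ((unop (Φ (unop η))).1 f) by
    simp
  smul_zero ξ := map_zero (unop (Φ (unop ξ))).1
  smul_add ξ f g := map_add (unop (Φ (unop ξ))).1 f g
  add_smul ξ η f := show (unop (Φ (unop (ξ + η)))).1 f =
      (unop (Φ (unop ξ))).1 f + (unop (Φ (unop η))).1 f by
    simp
  zero_smul f := show (unop (Φ (unop 0))).1 f = 0 by simp
  compat f g := show (unop (Φ (mulOp k R f))).1 g = f • g by
    rw [hΦ f]; rfl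

variable (k R)

/-- `Hom_k(R, k)`. -/
def KDual : Type (max u v) := R →ₗ[k] k

instance : AddCommGroup (KDual k R) := inferInstanceAs (AddCommGroup (R →ₗ[k] k))

/-- The `R`-module structure on `Hom_k(R, k)` by premultiplication: `(f • ψ) g = ψ (f * g)`. -/
instance : Module R (KDual k R) where
  smul f ψ := LinearMap.comp (show R →ₗ[k] k from ψ) (Algebra.lmul k R f)
  one_smul ψ := LinearMap.ext fun g => congrArg (show R →ₗ[k] k from ψ) (one_mul g)
  mul_smul f f' ψ := LinearMap.ext fun g => congrArg (show R →ₗ[k] k from ψ)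
    (show f * f' * g = f' * (f * g) by ring)
  smul_zero _ := LinearMap.ext fun _ => rfl
  smul_add _ _ _ := LinearMap.ext fun _ => rfl
  add_smul f f' ψ := LinearMap.ext fun g =>
    (congrArg (show R →ₗ[k] k from ψ) (add_mul f f' g)).trans
      (map_add (show R →ₗ[k] k from ψ) _ _)
  zero_smul ψ := LinearMap.ext fun g =>
    (congrArg (show R →ₗ[k] k from ψ) (zero_mul g)).trans (map_zero (show R →ₗ[k] k from ψ))

/-- The compatible right `D_{R|k}`-module structure on `Hom_k(R, k)` by precomposition:
`ψ · ξ = ψ ∘ ξ`. -/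
def CompatibleRightModule.dual : CompatibleRightModule k R (KDual k R) where
  smul ξ ψ := LinearMap.comp (show R →ₗ[k] k from ψ) (unop ξ).1
  one_smul _ := LinearMap.ext fun _ => rfl
  mul_smul _ _ _ := LinearMap.ext fun _ => rfl
  smul_zero _ := LinearMap.ext fun _ => rfl
  smul_add _ _ _ := LinearMap.ext fun _ => rfl
  add_smul ξ η ψ := LinearMap.ext fun g => map_add (show R →ₗ[k] k from ψ)
    ((unop ξ).1 g) ((unop η).1 g)
  zero_smul ψ := LinearMap.ext fun _ => map_zero (show R →ₗ[k] k from ψ)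
  compat _ _ := rfl

end DifferentialOperators

/-- A Gorenstein local ring: a Noetherian local ring that has finite injective dimension as a
module over itself. -/
structure IsGorensteinLocalRing (R : Type v) [CommRing R] : Prop where
  isLocalRing : IsLocalRing R
  isNoetherianRing : IsNoetherianRing R
  finite_injectiveDimension :
    ∃ n : ℕ, CategoryTheory.HasInjectiveDimensionLE (ModuleCat.of R R) n

/-- The field `k` is a coefficient field of the local `k`-algebra `R`: it maps isomorphically onto
the residue field of `R`. -/
def IsCoefficientField (k : Type u) (R : Type v) [Field k] [CommRing R] [IsLocalRing R]
    [Algebra k R] : Prop :=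
  Function.Bijective (algebraMap k (IsLocalRing.ResidueField R))

/-!
Write `D` for `DiffOp k R`.

*Reduced algebras, characteristic zero.* An anti-automorphism `Φ` fixing `R` satisfies
`[Φ(ξ), f] = -Φ([ξ, f])`, so a derivation `δ` has `Φ(δ) = -δ + a` with `a ∈ R`, and `Φ ∘ Φ` fixes
all operators of order at most one. The ring `D` need not be generated by these when `R` is
singular, but it is generically: since the module of differentials is finite, there are `xᵢ ∈ R`,
derivations `δᵢ` and `s ∈ R` with `∑ δᵢ(f) d(xᵢ) = s d(f)` for all derivations `d`, and `s` can be
chosen not to annihilate any given nonzero element (`exists_dual_derivations`). The Euler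
identity `∑ [ξ, xᵢ] δᵢ ≡ n s ξ` modulo operators of lower order, for `ξ` of order `n`
(`sum_commutatorOp_mul_derivationOp_sub_mem`), then gives `s (Φ(Φ(ξ)) - ξ) = 0` by induction
on `n`.

*Reduced algebras, characteristic `p`.* Let `q` be a power of `p` larger than the order of `ξ`
and let `A` be the subalgebra generated by the `q`-th powers. Then `ξ` is `A`-linear, because
`ad(f) ^ q = ad(f ^ q)`; conversely every `A`-linear map `R → R` is a differential operator, the
diagonal ideal of `R ⊗[A] R` being nilpotent (`restrictScalars_mem_diffOp`). For an `A`-linear form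
`l : R → A`, viewed in `D`, the relations `l b l = l(b) l` force `z Φ(Φ(l)) = z l` for every `z` in
the image of `Φ(l)`, which in a reduced ring yields `Φ(Φ(l)) = l`
(`antiMap_antiMap_of_apply_mem`). The same holds for the form `l ξ`, so
`l (Φ(Φ(ξ)) - ξ) = 0`, and such forms separate the points of `R`
(`exists_linearForm_apply_ne_zero`).

In both characteristics, the passage from residue fields back to `R` uses primes of the form
`P = Ann(s)`, for which multiplication by `s` embeds `R / P` in `R` (`exists_lift_residueField`).

*Right module structures from the dual.* If `Φ` comes from an isomorphism `φ` of `R` with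
`Hom_k(R, k)`, then `Φ(ξ)` is the adjoint of `ξ` for the nondegenerate symmetric form
`(f, g) ↦ φ(1)(f g)`, and the adjoint of the adjoint is the original operator.
-/

/-! ### Anti-automorphisms as maps, and adjoints for a symmetric form -/

section AntiAutomorphisms

variable {k : Type u} [Field k] {R : Type v} [CommRing R] [Algebra k R]

/-- The ring structure of `D_{R|k}`, for use as a local shortcut instance: without it, subtraction
is found through the additive subgroup structure and does not unify with subtraction in a ring. -/
abbrev DiffOp.ring : Ring (DiffOp k R) := Subalgebra.toRing (DiffOp k R)

attribute [local instance] DiffOp.ring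

theorem DiffOp.coe_mulOp (f : R) : (mulOp k R f : Module.End k R) = Algebra.lmul k R f := rfl

theorem DiffOp.mulOp_mul_apply (f : R) (ξ : DiffOp k R) (x : R) :
    (mulOp k R f * ξ).1 x = f * ξ.1 x := rfl

theorem DiffOp.mul_mulOp_apply (f : R) (ξ : DiffOp k R) (x : R) :
    (ξ * mulOp k R f).1 x = ξ.1 (f * x) := rfl

theorem DiffOp.ext_apply {ξ η : DiffOp k R} (h : ∀ x, ξ.1 x = η.1 x) : ξ = η :=
  Subtype.ext (LinearMap.ext h)

/-- An endomorphism commuting with `R` is multiplication by its value at `1`. -/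
theorem DiffOp.eq_mulOp_of_commute {ξ : DiffOp k R}
    (h : ∀ f, ξ * mulOp k R f = mulOp k R f * ξ) : ξ = mulOp k R (ξ.1 1) := by
  refine DiffOp.ext_apply fun x => ?_
  have := congrArg (fun η : DiffOp k R => η.1 1) (h x)
  simp only [DiffOp.mul_mulOp_apply, DiffOp.mulOp_mul_apply, mul_one] at this
  rw [this, DiffOp.coe_mulOp]
  exact mul_comm _ _

/-- The anti-automorphism `Φ` as a map from `D_{R|k}` to itself. -/
def antiMap (Φ : DiffOp k R ≃+* (DiffOp k R)ᵐᵒᵖ) : DiffOp k R →+ DiffOp k R where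
  toFun ξ := unop (Φ ξ)
  map_zero' := by simp
  map_add' := by simp

variable (Φ : DiffOp k R ≃+* (DiffOp k R)ᵐᵒᵖ)

theorem antiMap_mul (ξ η : DiffOp k R) :
    antiMap Φ (ξ * η) = antiMap Φ η * antiMap Φ ξ := by
  simp [antiMap]

theorem antiMap_injective : Function.Injective (antiMap Φ) :=
  unop_injective.comp Φ.injective

variable {Φ}

theorem antiMap_mulOp (hΦ : FixesBase Φ) (f : R) : antiMap Φ (mulOp k R f) = mulOp k R f := by
  simp [antiMap, hΦ f]

theorem isInvolutive_iff : IsInvolutive Φ ↔ ∀ ξ, antiMap Φ (antiMap Φ ξ) = ξ := Iff.rfl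

/-- For `φ` with `φ(Φ(ξ)(f)) = φ(f) ∘ ξ`, the operator `Φ(ξ)` is the adjoint of `ξ` for the
symmetric bilinear form `(f, g) ↦ φ(1)(f * g)`, which is nondegenerate since `φ` is injective. -/
theorem isInvolutive_of_ofAntiAut_eq_pullback (hΦ : FixesBase Φ) (φ : R ≃ₗ[R] KDual k R)
    (h : CompatibleRightModule.ofAntiAut Φ hΦ = (CompatibleRightModule.dual k R).pullback φ) :
    IsInvolutive Φ := by
  let B : R → R → k := fun f g => (show R →ₗ[k] k from φ f) g
  have hB (f g : R) : B f g = (show R →ₗ[k] k from φ 1) (f * g) := by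
    have : φ f = f • φ 1 := by rw [← map_smul, smul_eq_mul, mul_one]
    simp only [B, this]
    rfl
  have hsymm (f g : R) : B f g = B g f := by rw [hB, hB, mul_comm]
  have hinj {f g : R} (hfg : ∀ x, B f x = B g x) : f = g :=
    φ.injective (LinearMap.ext (f := (show R →ₗ[k] k from φ f)) hfg)
  have hadj (ξ : DiffOp k R) (f g : R) : B ((antiMap Φ ξ).1 f) g = B f (ξ.1 g) := by
    have h₁ : (antiMap Φ ξ).1 f =
        φ.symm (LinearMap.comp (show R →ₗ[k] k from φ f) ξ.1 : R →ₗ[k] k) :=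
      congrArg (fun S : CompatibleRightModule k R R => S.smul (op ξ) f) h
    simp only [B, h₁]
    have h₂ := φ.apply_symm_apply (LinearMap.comp (show R →ₗ[k] k from φ f) ξ.1 : R →ₗ[k] k)
    exact congrArg (fun ψ : KDual k R => (show R →ₗ[k] k from ψ) g) h₂
  rw [isInvolutive_iff]
  refine fun ξ => DiffOp.ext_apply fun f => hinj fun g => ?_
  rw [hadj, hsymm, hadj, hsymm]

end AntiAutomorphisms

/-! ### Clearing denominators at a prime annihilator -/

section ClearingDenominators

/-- A nonzero element `x` of a reduced Noetherian ring lies outside some prime of the form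
`Ann(s)`. -/
theorem exists_prime_annihilator {R : Type v} [CommRing R] [IsNoetherianRing R] [IsReduced R]
    {x : R} (hx : x ≠ 0) :
    ∃ (s : R) (P : Ideal R), P.IsPrime ∧ (∀ a, a ∈ P ↔ s * a = 0) ∧ x ∉ P := by
  obtain ⟨P, hP, hle⟩ := exists_le_isAssociatedPrime_of_isNoetherianRing R x hx
  obtain ⟨hprime, s, hs⟩ := Submodule.isAssociatedPrime_iff.1 hP
  have hmem (a : R) : a ∈ P ↔ s * a = 0 := by
    rw [hs, Submodule.mem_colon_singleton, Submodule.mem_bot, smul_eq_mul, mul_comm]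
  refine ⟨s, P, hprime, hmem, fun hxP => hprime.ne_top ?_⟩
  -- If `s * x = 0` then `s ∈ Ann(x) ≤ Ann(s)`, so `s ^ 2 = 0` and `s = 0`.
  have hsP : s ∈ P := hle <| by
    rw [Submodule.mem_colon_singleton, Submodule.mem_bot, smul_eq_mul, ← hmem]
    exact hxP
  have hs0 : s = 0 := IsReduced.eq_zero s ⟨2, (sq s).trans ((hmem s).1 hsP)⟩
  rw [Ideal.eq_top_iff_one, hmem, hs0, zero_mul]

/-- Let `P = Ann(s)` be prime. A linear map from a finite module to the residue field of `P` has a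
multiple `t • f`, `t ∉ P`, with values in `A / P`, and multiplication by `s` carries `A / P`
injectively into `A`; a finite family of maps admits a common `t`. -/
theorem exists_lift_residueField {A : Type*} [CommRing A] {s : A} {P : Ideal A} [P.IsPrime]
    (hP : ∀ a, a ∈ P ↔ s * a = 0) {M : Type*} [AddCommGroup M] [Module A M] [Module.Finite A M]
    {ι : Type*} [Finite ι] (f : ι → M →ₗ[A] P.ResidueField) :
    ∃ t ∉ P, ∃ g : ι → M →ₗ[A] A, ∀ i m, ∃ r, g i m = s * r ∧
      algebraMap A P.ResidueField r = t • f i m := by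
  classical
  obtain ⟨S, hS⟩ := (Module.Finite.fg_top : (⊤ : Submodule A M).FG)
  obtain ⟨t, ht⟩ := IsLocalization.exist_integer_multiples_of_finite (nonZeroDivisors (A ⧸ P))
    (fun p : ι × S => f p.1 p.2)
  obtain ⟨t, ht0⟩ := t
  obtain ⟨t, rfl⟩ := Ideal.Quotient.mk_surjective t
  have key (i) (m : M) : ∃ r : A, algebraMap A P.ResidueField r = t • f i m := by
    have hm : m ∈ Submodule.span A (S : Set M) := hS ▸ Submodule.mem_top
    induction hm using Submodule.span_induction with
    | mem m hm =>
      obtain ⟨r, hr⟩ := ht (i, ⟨m, hm⟩)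
      obtain ⟨r, rfl⟩ := Ideal.Quotient.mk_surjective r
      refine ⟨r, hr.trans ?_⟩
      rw [Algebra.smul_def, Algebra.smul_def, IsScalarTower.algebraMap_apply A (A ⧸ P)]
      rfl
    | zero => exact ⟨0, by simp⟩
    | add a b _ _ ha hb =>
      obtain ⟨r, hr⟩ := ha
      obtain ⟨r', hr'⟩ := hb
      exact ⟨r + r', by simp [hr, hr']⟩
    | smul c a _ ha =>
      obtain ⟨r, hr⟩ := ha
      exact ⟨c * r, by rw [map_mul, hr, map_smul, smul_comm t, Algebra.smul_def c]⟩
  choose r hr using key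
  have hs {a b : A} (h : algebraMap A P.ResidueField a = algebraMap A P.ResidueField b) :
      s * a = s * b := by
    have : a - b ∈ P := by
      rw [← Ideal.algebraMap_residueField_eq_zero, map_sub, h, sub_self]
    rw [hP, mul_sub, sub_eq_zero] at this
    exact this
  refine ⟨t, fun h => ?_, fun i =>
    { toFun := fun m => s * r i m
      map_add' := fun a b => ?_
      map_smul' := fun c a => ?_ }, fun i m => ⟨r i m, rfl, hr i m⟩⟩
  · exact nonZeroDivisors.ne_zero ht0 (Ideal.Quotient.eq_zero_iff_mem.2 h)
  · rw [← mul_add]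
    exact hs (by simp [hr])
  · rw [RingHom.id_apply, smul_eq_mul, mul_left_comm]
    exact hs (by rw [map_mul, hr, hr, map_smul, smul_comm t, Algebra.smul_def c])

end ClearingDenominators

/-! ### Operators of order at most one -/

section OrderOne

attribute [local instance] DiffOp.ring

variable {k : Type u} [Field k] {R : Type v} [CommRing R] [Algebra k R]
  {Φ : DiffOp k R ≃+* (DiffOp k R)ᵐᵒᵖ}

/-- If `[δ, f] ∈ R` for all `f ∈ R`, then `[Φ(δ), f] = -[δ, f]`, so that `Φ(δ) = -δ + a` for some
`a ∈ R`, whence `Φ(Φ(δ)) = δ`. -/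
theorem antiMap_antiMap_of_order_le_one (hΦ : FixesBase Φ) {δ : DiffOp k R}
    (hδ : ∀ f, ∃ g, δ * mulOp k R f - mulOp k R f * δ = mulOp k R g) :
    antiMap Φ (antiMap Φ δ) = δ := by
  have h : antiMap Φ δ + δ = mulOp k R ((antiMap Φ δ + δ).1 1) := by
    refine DiffOp.eq_mulOp_of_commute fun f => ?_
    obtain ⟨g, hg⟩ := hδ f
    have := congrArg (antiMap Φ) hg
    rw [map_sub, antiMap_mul, antiMap_mul, antiMap_mulOp hΦ, antiMap_mulOp hΦ, ← hg,
      ← sub_eq_zero] at this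
    rw [← sub_eq_zero, ← neg_eq_zero, ← this]
    noncomm_ring
  set a := (antiMap Φ δ + δ).1 1
  have h' : antiMap Φ δ = mulOp k R a - δ := by rw [← h, add_sub_cancel_right]
  rw [h', map_sub, antiMap_mulOp hΦ, h', sub_sub_cancel]

/-- A derivation, as a differential operator. -/
def derivationOp (δ : Derivation k R R) : DiffOp k R :=
  ⟨δ.toLinearMap, 1, fun f => ⟨δ f, LinearMap.ext fun x => by simp [mul_comm]⟩⟩

theorem derivationOp_commutator (δ : Derivation k R R) (f : R) :
    derivationOp δ * mulOp k R f - mulOp k R f * derivationOp δ = mulOp k R (δ f) := by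
  refine DiffOp.ext_apply fun x => ?_
  change δ (f * x) - f * δ x = δ f * x
  simp [mul_comm]

theorem antiMap_antiMap_derivationOp (hΦ : FixesBase Φ) (δ : Derivation k R R) :
    antiMap Φ (antiMap Φ (derivationOp δ)) = derivationOp δ :=
  antiMap_antiMap_of_order_le_one hΦ fun f => ⟨δ f, derivationOp_commutator δ f⟩

end OrderOne

/-! ### The Euler identity -/

section CharZero

attribute [local instance] DiffOp.ring

variable {k : Type u} [Field k] {R : Type v} [CommRing R] [Algebra k R]

/-- The commutator `[ξ, f]`. -/
def commutatorOp (ξ : DiffOp k R) (f : R) : DiffOp k R := ξ * mulOp k R f - mulOp k R f * ξ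

theorem commutatorOp_def (ξ : DiffOp k R) (f : R) :
    commutatorOp ξ f = ξ * mulOp k R f - mulOp k R f * ξ := rfl

variable (k R) in
/-- The differential operators of order less than `n`: unlike `diffOpLE`, this indexing includes the
zero module of operators of order at most `-1`. -/
def orderLT : ℕ → Set (DiffOp k R)
  | 0 => {0}
  | n + 1 => {ξ | ∀ f, commutatorOp ξ f ∈ orderLT n}

theorem mem_orderLT_of_mem_diffOpLE {n : ℕ} {ξ : DiffOp k R} (h : ξ.1 ∈ diffOpLE k R n) :
    ξ ∈ orderLT k R (n + 1) := by
  induction n generalizing ξ with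
  | zero =>
    obtain ⟨g, hg⟩ := h
    obtain rfl : mulOp k R g = ξ := Subtype.ext hg
    intro f
    change _ - _ = _
    rw [← map_mul, ← map_mul, mul_comm, sub_self]
  | succ n ih => exact fun f => ih (h f)

theorem exists_mem_orderLT (ξ : DiffOp k R) : ∃ n, ξ ∈ orderLT k R n :=
  let ⟨n, hn⟩ := ξ.2
  ⟨n + 1, mem_orderLT_of_mem_diffOpLE hn⟩

theorem add_mem_orderLT {n : ℕ} {ξ η : DiffOp k R} (hξ : ξ ∈ orderLT k R n)
    (hη : η ∈ orderLT k R n) : ξ + η ∈ orderLT k R n := by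
  induction n generalizing ξ η with
  | zero =>
    obtain rfl : ξ = 0 := hξ
    obtain rfl : η = 0 := hη
    exact add_zero 0
  | succ n ih =>
    intro f
    have : commutatorOp (ξ + η) f = commutatorOp ξ f + commutatorOp η f := by
      simp only [commutatorOp]; noncomm_ring
    rw [this]
    exact ih (hξ f) (hη f)

variable {ι : Type*} [Fintype ι] {x : ι → R} {δ : ι → Derivation k R R} {s : R}

/-- An operator of order at most `1` is a derivation plus an element of `R`. -/
theorem exists_derivation_commutatorOp {ξ : DiffOp k R} (hξ : ξ ∈ orderLT k R 2) :
    ∃ d : Derivation k R R, ∀ f, commutatorOp ξ f = mulOp k R (d f) := by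
  have h (f : R) : commutatorOp ξ f = mulOp k R (ξ.1 f - f * ξ.1 1) := by
    refine (DiffOp.eq_mulOp_of_commute fun g => sub_eq_zero.1 (hξ f g)).trans (congrArg _ ?_)
    change ξ.1 (f * 1) - f * ξ.1 1 = _
    rw [mul_one]
  have hcomm (f g : R) : ξ.1 (f * g) - f * ξ.1 g = (ξ.1 f - f * ξ.1 1) * g :=
    congrArg (fun η : DiffOp k R => η.1 g) (h f)
  refine ⟨Derivation.mk' (ξ.1 - LinearMap.mulRight k (ξ.1 1)) fun f g => ?_, h⟩
  simp only [LinearMap.sub_apply, LinearMap.mulRight_apply, smul_eq_mul]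
  linear_combination hcomm f g

/-- If `∑ δᵢ(f) d(xᵢ) = s d(f)` for every derivation `d`, the same identity holds for symbols of
operators of any order. -/
theorem sum_smul_commutatorOp_sub_mem
    (hs : ∀ (d : Derivation k R R) (f : R), ∑ i, δ i f * d (x i) = s * d f)
    {n : ℕ} {ξ : DiffOp k R} (hξ : ξ ∈ orderLT k R (n + 2)) (f : R) :
    ∑ i, mulOp k R (δ i f) * commutatorOp ξ (x i) - mulOp k R s * commutatorOp ξ f ∈
      orderLT k R n := by
  induction n generalizing ξ with
  | zero =>
    obtain ⟨d, hd⟩ := exists_derivation_commutatorOp hξ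
    change _ = _
    simp only [hd, ← map_mul, ← map_sum, hs, sub_self]
  | succ n ih =>
    intro g
    convert ih (hξ g) using 1
    have hc (a h : R) : commutatorOp (mulOp k R a * commutatorOp ξ h) g =
        mulOp k R a * commutatorOp (commutatorOp ξ g) h := by
      have h₁ : mulOp k R g * mulOp k R a = mulOp k R a * mulOp k R g := by
        rw [← map_mul, ← map_mul, mul_comm]
      have h₂ : mulOp k R h * mulOp k R g = mulOp k R g * mulOp k R h := by
        rw [← map_mul, ← map_mul, mul_comm]
      simp only [commutatorOp, mul_sub, sub_mul, ← mul_assoc, h₁]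
      simp only [mul_assoc, h₂]
      abel
    simp only [← hc]
    simp only [commutatorOp, sub_mul, mul_sub, Finset.sum_mul, Finset.mul_sum,
      Finset.sum_sub_distrib]
    abel

theorem zero_mem_orderLT (n : ℕ) : (0 : DiffOp k R) ∈ orderLT k R n := by
  induction n with
  | zero => rfl
  | succ n ih =>
    intro f
    simpa only [commutatorOp, zero_mul, mul_zero, sub_zero] using ih

theorem sum_mem_orderLT {n : ℕ} {ξ : ι → DiffOp k R} (h : ∀ i, ξ i ∈ orderLT k R n) :
    ∑ i, ξ i ∈ orderLT k R n :=
  Finset.sum_induction ξ (· ∈ orderLT k R n) (fun _ _ => add_mem_orderLT) (zero_mem_orderLT n)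
    fun i _ => h i

/-- The Euler identity: if `∑ δᵢ(f) d(xᵢ) = s d(f)` for every derivation `d`, then
`∑ [ξ, xᵢ] δᵢ = n s ξ` up to lower order terms, for `ξ` of order at most `n`. -/
theorem sum_commutatorOp_mul_derivationOp_sub_mem
    (hs : ∀ (d : Derivation k R R) (f : R), ∑ i, δ i f * d (x i) = s * d f)
    {n : ℕ} {ξ : DiffOp k R} (hξ : ξ ∈ orderLT k R (n + 1)) :
    ∑ i, commutatorOp ξ (x i) * derivationOp (δ i) - n • (mulOp k R s * ξ) ∈ orderLT k R n := by
  induction n generalizing ξ with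
  | zero =>
    have h (f : R) : commutatorOp ξ f = 0 := hξ f
    change _ = _
    simp [h]
  | succ n ih =>
    intro f
    have h₁ := ih (hξ f)
    have h₂ := sum_smul_commutatorOp_sub_mem hs hξ f
    have h₃ := sum_mem_orderLT fun i => hξ (x i) (δ i f)
    -- Moving `[δᵢ, f] = δᵢ(f)` to the left of `[ξ, xᵢ]` costs the lower order term `[[ξ, xᵢ], δᵢ(f)]`.
    have hc (i : ι) : commutatorOp (commutatorOp ξ (x i) * derivationOp (δ i)) f =
        commutatorOp (commutatorOp ξ f) (x i) * derivationOp (δ i) +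
          mulOp k R (δ i f) * commutatorOp ξ (x i) +
          commutatorOp (commutatorOp ξ (x i)) (δ i f) := by
      have h₁ : mulOp k R f * mulOp k R (x i) = mulOp k R (x i) * mulOp k R f := by
        rw [← map_mul, ← map_mul, mul_comm]
      have h₂ : commutatorOp (commutatorOp ξ f) (x i) = commutatorOp (commutatorOp ξ (x i)) f := by
        simp only [commutatorOp, mul_sub, sub_mul, ← mul_assoc, h₁]
        simp only [mul_assoc, h₁]
        abel
      rw [h₂, commutatorOp_def, commutatorOp_def (commutatorOp ξ (x i)) (δ i f),
        commutatorOp_def (commutatorOp ξ (x i)) f, ← derivationOp_commutator]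
      noncomm_ring
    have hs' : commutatorOp (mulOp k R s * ξ) f = mulOp k R s * commutatorOp ξ f := by
      have h₁ : mulOp k R f * mulOp k R s = mulOp k R s * mulOp k R f := by
        rw [← map_mul, ← map_mul, mul_comm]
      simp only [commutatorOp, mul_sub, ← mul_assoc, h₁]
    have hlin : commutatorOp (∑ i, commutatorOp ξ (x i) * derivationOp (δ i) -
        (n + 1) • (mulOp k R s * ξ)) f =
        ∑ i, commutatorOp (commutatorOp ξ (x i) * derivationOp (δ i)) f -
          (n + 1) • commutatorOp (mulOp k R s * ξ) f := by
      simp only [commutatorOp_def _ f, sub_mul, mul_sub, Finset.sum_mul,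
        Finset.mul_sum, Finset.sum_sub_distrib, smul_sub, smul_mul_assoc, mul_smul_comm]
      abel
    rw [hlin, hs']
    convert add_mem_orderLT (add_mem_orderLT h₁ h₂) h₃ using 1
    simp only [hc, Finset.sum_add_distrib, succ_nsmul]
    abel

variable {Φ : DiffOp k R ≃+* (DiffOp k R)ᵐᵒᵖ}

/-- By the Euler identity, `n s ξ` is built from derivations and operators of lower order, so
induction on the order applies. -/
theorem mulOp_mul_antiMap_antiMap [CharZero k] [IsReduced R] (hΦ : FixesBase Φ)
    (hs : ∀ (d : Derivation k R R) (f : R), ∑ i, δ i f * d (x i) = s * d f)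
    {n : ℕ} {ξ : DiffOp k R} (hξ : ξ ∈ orderLT k R n) :
    mulOp k R s * antiMap Φ (antiMap Φ ξ) = mulOp k R s * ξ := by
  induction n generalizing ξ with
  | zero =>
    obtain rfl : ξ = 0 := hξ
    simp
  | succ n ih =>
    rcases Nat.eq_zero_or_pos n with rfl | hn
    · rw [DiffOp.eq_mulOp_of_commute fun f => sub_eq_zero.1 (hξ f), antiMap_mulOp hΦ,
        antiMap_mulOp hΦ]
    have h := ih (sum_commutatorOp_mul_derivationOp_sub_mem hs hξ)
    simp only [map_sub, map_sum, antiMap_mul, antiMap_antiMap_derivationOp hΦ, map_nsmul,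
      antiMap_mulOp hΦ, mul_sub, Finset.mul_sum, ← mul_assoc] at h
    simp only [fun i => ih (hξ (x i))] at h
    rw [sub_right_inj, mul_smul_comm, mul_smul_comm] at h
    -- `h` says `n s ^ 2 (Φ(Φ(ξ)) - ξ) = 0`; reducedness turns `s ^ 2` into `s`.
    refine DiffOp.ext_apply fun y => sub_eq_zero.1 (IsReduced.eq_zero _ ⟨2, ?_⟩)
    have hy := congrArg (fun η : DiffOp k R => η.1 y) h
    change n • (s * (s * (antiMap Φ (antiMap Φ ξ)).1 y)) = n • (s * (s * ξ.1 y)) at hy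
    change (s * (antiMap Φ (antiMap Φ ξ)).1 y - s * ξ.1 y) ^ 2 = 0
    have hk : ((n : k)) ≠ 0 := by exact_mod_cast hn.ne'
    rw [← Nat.cast_smul_eq_nsmul k, ← Nat.cast_smul_eq_nsmul k, smul_right_inj hk] at hy
    linear_combination ((antiMap Φ (antiMap Φ ξ)).1 y - ξ.1 y) * hy

end CharZero

/-! ### Dual derivations and characteristic zero -/

section DualDerivations

attribute [local instance] DiffOp.ring

open TensorProduct KaehlerDifferential

variable {k : Type u} [Field k] {R : Type v} [CommRing R] [Algebra k R]

/-- The hypothesis of the Euler identity holds for some `s` not annihilating a given `y ≠ 0`. With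
`P ∌ y` a prime of the form `Ann(s₀)`, some `dxᵢ` form a basis of `κ(P) ⊗ Ω`, and the
derivations are multiples of the dual basis with denominators cleared. -/
theorem exists_dual_derivations [IsReduced R] [Algebra.EssFiniteType k R] {y : R} (hy : y ≠ 0) :
    ∃ (n : ℕ) (x : Fin n → R) (δ : Fin n → Derivation k R R) (s : R),
      (∀ (d : Derivation k R R) (f : R), ∑ i, δ i f * d (x i) = s * d f) ∧ s * y ≠ 0 := by
  classical
  have : IsNoetherianRing R := Algebra.EssFiniteType.isNoetherianRing k R
  obtain ⟨s, P, hP, hmem, hyP⟩ := exists_prime_annihilator hy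
  let K := P.ResidueField
  let V := K ⊗[R] Ω[R⁄k]
  have hspan : ⊤ ≤ Submodule.span K (Set.range fun f : R => (1 : K) ⊗ₜ[R] D k R f) := by
    rintro v -
    induction v using TensorProduct.induction_on with
    | zero => exact Submodule.zero_mem _
    | add a b ha hb => exact Submodule.add_mem _ ha hb
    | tmul c w =>
      have hw : w ∈ Submodule.span R (Set.range (D k R)) := by
        rw [span_range_derivation]; trivial
      have hc (w : Ω[R⁄k]) : c ⊗ₜ[R] w = c • ((1 : K) ⊗ₜ[R] w) := by
        rw [TensorProduct.smul_tmul', smul_eq_mul, mul_one]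
      rw [hc]
      refine Submodule.smul_mem _ _ ?_
      induction hw using Submodule.span_induction with
      | mem w hw =>
        obtain ⟨f, rfl⟩ := hw
        exact Submodule.subset_span ⟨f, rfl⟩
      | zero => rw [TensorProduct.tmul_zero]; exact Submodule.zero_mem _
      | add a b _ _ ha hb => rw [TensorProduct.tmul_add]; exact Submodule.add_mem _ ha hb
      | smul r a _ ha =>
        rw [TensorProduct.tmul_smul, ← algebraMap_smul K r]
        exact Submodule.smul_mem _ _ ha
  let b₀ := Module.Basis.ofSpan hspan
  have hb₀ (i) : ∃ f : R, (1 : K) ⊗ₜ[R] D k R f = b₀ i :=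
    Module.Basis.ofSpan_subset hspan ⟨i, rfl⟩
  have hfin := Module.Finite.finite_basis b₀
  obtain ⟨n, ⟨e⟩⟩ := Finite.exists_equiv_fin _ (h := hfin)
  let b := b₀.reindex e
  have hb (i) : ∃ f : R, (1 : K) ⊗ₜ[R] D k R f = b i := by
    rw [Module.Basis.reindex_apply]
    exact hb₀ _
  choose x hx using hb
  obtain ⟨t, htP, g, hg⟩ := exists_lift_residueField hmem fun i =>
    ((b.coord i).restrictScalars R).comp (TensorProduct.mk R K Ω[R⁄k] 1)
  choose r hgr hr using hg
  refine ⟨n, x, fun i => (g i).compDer (D k R), s * t, fun d f => ?_, ?_⟩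
  · let u : V →ₗ[K] K := LinearMap.liftBaseChange K
      ((Algebra.linearMap R K).comp d.liftKaehlerDifferential)
    have hu (f : R) : u ((1 : K) ⊗ₜ[R] D k R f) = algebraMap R K (d f) := by
      rw [LinearMap.liftBaseChange_tmul, one_smul, LinearMap.comp_apply,
        Derivation.liftKaehlerDifferential_comp_D]
      rfl
    have hsum := congrArg u (b.sum_repr ((1 : K) ⊗ₜ[R] D k R f))
    simp only [map_sum, map_smul, ← hx, hu] at hsum
    have hmemP : ∑ i, r i (D k R f) * d (x i) - t * d f ∈ P := by
      rw [← Ideal.algebraMap_residueField_eq_zero, map_sub, map_sum, sub_eq_zero, map_mul,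
        ← hsum, Finset.mul_sum]
      refine Finset.sum_congr rfl fun i _ => ?_
      rw [map_mul, hr, Algebra.smul_def, smul_eq_mul, mul_assoc]
      rfl
    rw [hmem, mul_sub, sub_eq_zero, Finset.mul_sum, ← mul_assoc] at hmemP
    rw [← hmemP]
    refine Finset.sum_congr rfl fun i _ => ?_
    rw [← mul_assoc, ← hgr]
    rfl
  · rw [mul_assoc, ne_eq, ← hmem, hP.mul_mem_iff_mem_or_mem]
    tauto

/-- The characteristic zero case for reduced algebras. -/
theorem isInvolutive_of_charZero [CharZero k] [IsReduced R] [Algebra.EssFiniteType k R]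
    {Φ : DiffOp k R ≃+* (DiffOp k R)ᵐᵒᵖ} (hΦ : FixesBase Φ) : IsInvolutive Φ := by
  rw [isInvolutive_iff]
  refine fun ξ => DiffOp.ext_apply fun y => sub_eq_zero.1 (of_not_not fun hy => ?_)
  obtain ⟨m, x, δ, s, hs, hsy⟩ := exists_dual_derivations (k := k) hy
  obtain ⟨n, hn⟩ := exists_mem_orderLT ξ
  refine hsy ?_
  rw [mul_sub, sub_eq_zero]
  exact congrArg (fun η : DiffOp k R => η.1 y) (mulOp_mul_antiMap_antiMap hΦ hs hn)

end DualDerivations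

/-! ### Linearity over powers in characteristic `p` -/

section IteratedCommutators

attribute [local instance] DiffOp.ring

variable {k : Type u} [Field k] {R : Type v} [CommRing R] [Algebra k R]

/-- The subalgebra of `R` generated over `k` by the `q`-th powers. -/
def powSubalgebra (k : Type u) (R : Type v) [Field k] [CommRing R] [Algebra k R] (q : ℕ) :
    Subalgebra k R :=
  Algebra.adjoin k (Set.range fun f : R => f ^ q)

theorem pow_mem_powSubalgebra (q : ℕ) (f : R) : f ^ q ∈ powSubalgebra k R q :=
  Algebra.subset_adjoin ⟨f, rfl⟩

/-- In characteristic `p`, `ad(f) ^ q = ad(f ^ q)` for a power `q` of `p`, so operators of order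
less than `q` are linear over `q`-th powers. -/
theorem commute_mulOp_of_mem_powSubalgebra {p : ℕ} [Fact p.Prime] [CharP k p] {n e : ℕ}
    (hn : n ≤ p ^ e) {ξ : DiffOp k R} (hξ : ξ ∈ orderLT k R n) {a : R}
    (ha : a ∈ powSubalgebra k R (p ^ e)) : Commute ξ (mulOp k R a) := by
  rcases subsingleton_or_nontrivial (DiffOp k R) with h | h
  · exact Subsingleton.elim _ _
  have : CharP (Module.End k (DiffOp k R)) p :=
    charP_of_injective_algebraMap (algebraMap k (Module.End k (DiffOp k R))).injective p
  induction ha using Algebra.adjoin_induction with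
  | mem a ha =>
    obtain ⟨f, rfl⟩ := ha
    let ad : Module.End k (DiffOp k R) :=
      LinearMap.mulRight k (mulOp k R f) - LinearMap.mulLeft k (mulOp k R f)
    have had (m : ℕ) : ∀ {η : DiffOp k R}, η ∈ orderLT k R m → (ad ^ m) η = 0 := by
      induction m with
      | zero => exact fun h => h
      | succ m ih =>
        intro η hη
        rw [pow_succ]
        exact ih (hη f)
    have h₁ : (ad ^ p ^ e) ξ = 0 := by
      rw [← Nat.sub_add_cancel hn, pow_add, Module.End.mul_apply, had n hξ, map_zero]
    rw [sub_pow_char_pow_of_commute _ _ (LinearMap.commute_mulLeft_right _ _).symm,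
      LinearMap.pow_mulRight, LinearMap.pow_mulLeft, ← map_pow] at h₁
    exact sub_eq_zero.1 h₁
  | algebraMap c =>
    rw [AlgHom.commutes]
    exact Algebra.commutes' c ξ |>.symm
  | add a b _ _ ha hb => rw [map_add]; exact ha.add_right hb
  | mul a b _ _ ha hb => rw [map_mul]; exact ha.mul_right hb

end IteratedCommutators

/-! ### Linear maps over subrings of powers are differential operators -/

section LinearOperators

open TensorProduct

variable {k : Type u} [Field k] {R : Type v} [CommRing R] [Algebra k R]

/-- The action of `R ⊗ R` on an `A`-linear endomorphism `ξ` of `R`: the tensor `a ⊗ b` acts by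
`a ∘ ξ ∘ b`. -/
def bimoduleAction {A : Type*} [CommRing A] [Algebra A R] (ξ : R →ₗ[A] R) :
    R ⊗[A] R →ₗ[A] R →ₗ[A] R :=
  TensorProduct.lift <| LinearMap.mk₂ A
    (fun a b => LinearMap.mulLeft A a ∘ₗ ξ ∘ₗ LinearMap.mulLeft A b)
    (fun a a' b => by ext; simp [add_mul])
    (fun c a b => by ext; simp)
    (fun a b b' => by ext; simp [add_mul, mul_add])
    (fun c a b => by ext; simp)

theorem bimoduleAction_tmul {A : Type*} [CommRing A] [Algebra A R] (ξ : R →ₗ[A] R) (a b x : R) :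
    bimoduleAction ξ (a ⊗ₜ b) x = a * ξ (b * x) := rfl

/-- Taking the commutator with `f` is the action of `1 ⊗ f - f ⊗ 1`, and these elements generate the
diagonal ideal `I`; so an endomorphism killed by `I ^ (n + 1)` has order at most `n`. -/
theorem mem_diffOpLE_of_bimoduleAction_eq_zero {A : Type*} [CommRing A] [Algebra k A] [Algebra A R]
    [IsScalarTower k A R] {n : ℕ} {ξ : R →ₗ[A] R}
    (h : ∀ t ∈ KaehlerDifferential.ideal A R ^ (n + 1), bimoduleAction ξ t = 0) :
    ξ.restrictScalars k ∈ diffOpLE k R n := by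
  have hI (f : R) : (1 : R) ⊗ₜ[A] f - f ⊗ₜ[A] (1 : R) ∈ KaehlerDifferential.ideal A R :=
    KaehlerDifferential.one_smul_sub_smul_one_mem_ideal A f
  induction n generalizing ξ with
  | zero =>
    refine ⟨ξ 1, LinearMap.ext fun x => ?_⟩
    have := LinearMap.congr_fun (h _ (by rw [zero_add, pow_one]; exact hI x)) 1
    rw [map_sub, LinearMap.sub_apply, bimoduleAction_tmul, bimoduleAction_tmul] at this
    simp only [one_mul, mul_one, LinearMap.zero_apply, sub_eq_zero] at this
    exact (mul_comm _ _).trans this.symm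
  | succ n ih =>
    intro f
    refine ih (ξ := ξ ∘ₗ LinearMap.mulLeft A f - LinearMap.mulLeft A f ∘ₗ ξ) fun t ht => ?_
    have key (t : R ⊗[A] R) :
        bimoduleAction (ξ ∘ₗ LinearMap.mulLeft A f - LinearMap.mulLeft A f ∘ₗ ξ) t =
        bimoduleAction ξ (t * ((1 : R) ⊗ₜ[A] f - f ⊗ₜ[A] (1 : R))) := by
      induction t using TensorProduct.induction_on with
      | zero => simp
      | add a b ha hb => rw [map_add, add_mul, map_add, ha, hb]
      | tmul a b =>
        ext x
        simp only [mul_sub, map_sub, Algebra.TensorProduct.tmul_mul_tmul, LinearMap.sub_apply,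
          bimoduleAction_tmul, LinearMap.comp_apply, LinearMap.mulLeft_apply, mul_one, mul_assoc,
          mul_left_comm f]
    rw [key]
    exact h _ (Ideal.mul_mem_mul ht (hI f))

/-- If the diagonal ideal of `R ⊗[A] R` consists of nilpotents, it is nilpotent, being finitely
generated; so every `A`-linear endomorphism of `R` is a differential operator. -/
theorem restrictScalars_mem_diffOp {A : Type*} [CommRing A] [Algebra k A] [Algebra A R]
    [IsScalarTower k A R] [Algebra.EssFiniteType A R]
    (h : ∀ f : R, IsNilpotent ((1 : R) ⊗ₜ[A] f - f ⊗ₜ[A] (1 : R))) (ξ : R →ₗ[A] R) :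
    ξ.restrictScalars k ∈ DiffOp k R := by
  have hle : KaehlerDifferential.ideal A R ≤ nilradical (R ⊗[A] R) := by
    rw [← KaehlerDifferential.span_range_eq_ideal, Ideal.span_le]
    rintro _ ⟨f, rfl⟩
    exact h f
  obtain ⟨n, hn⟩ :=
    (Ideal.FG.isNilpotent_iff_le_nilradical (KaehlerDifferential.ideal_fg A R)).2 hle
  refine ⟨n, mem_diffOpLE_of_bimoduleAction_eq_zero (A := A) fun t ht => ?_⟩
  rw [pow_succ, hn, zero_mul] at ht
  rw [show t = 0 from ht, map_zero]

theorem isNilpotent_one_tmul_sub {p : ℕ} [Fact p.Prime] [CharP k p] {e : ℕ} (A : Subalgebra k R)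
    (hA : ∀ f : R, f ^ p ^ e ∈ A) (f : R) :
    IsNilpotent ((1 : R) ⊗ₜ[A] f - f ⊗ₜ[A] (1 : R)) := by
  nontriviality R ⊗[A] R
  have : CharP (R ⊗[A] R) p :=
    charP_of_injective_ringHom ((algebraMap A (R ⊗[A] R)).comp (algebraMap k A)).injective p
  refine ⟨p ^ e, ?_⟩
  rw [sub_pow_char_pow, Algebra.TensorProduct.tmul_pow, Algebra.TensorProduct.tmul_pow, one_pow,
    sub_eq_zero]
  have := TensorProduct.smul_tmul (R := A) (⟨f ^ p ^ e, hA f⟩ : A) (1 : R) (1 : R)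
  simpa [Algebra.smul_def] using this.symm

end LinearOperators

/-! ### Linear forms separating points -/

section LinearForms

variable {k : Type u} [Field k] {R : Type v} [CommRing R] [Algebra k R]

/-- If `A` contains a power `f ^ q` of each element, then `R` is integral over `A`, and inverting
`t` amounts to inverting `t ^ q`, so `R` is finite over `A`. -/
theorem finite_of_pow_mem [Algebra.EssFiniteType k R] (A : Subalgebra k R) {q : ℕ} (hq : 0 < q)
    (hA : ∀ f : R, f ^ q ∈ A) : Module.Finite A R := by
  have : Algebra.IsIntegral A R := ⟨fun f => by
    refine IsIntegral.of_pow hq ?_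
    exact isIntegral_algebraMap (R := A) (x := ⟨f ^ q, hA f⟩)⟩
  obtain ⟨σ, hσ⟩ := (Algebra.essFiniteType_iff k R).1 inferInstance
  have hle (f : R) (hf : f ∈ Algebra.adjoin k (σ : Set R)) : f ∈ Algebra.adjoin A (σ : Set R) := by
    have : Algebra.adjoin k (σ : Set R) ≤
        (Algebra.adjoin A (σ : Set R)).restrictScalars k :=
      Algebra.adjoin_le Algebra.subset_adjoin
    exact this hf
  have : Algebra.FiniteType A R := ⟨σ, by
    rw [eq_top_iff]
    rintro f -
    obtain ⟨t, ht, hu, hft⟩ := hσ f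
    obtain ⟨u, rfl⟩ := hu
    -- `f = (f u) u ^ (q - 1) (u⁻¹) ^ q`
    have hf : f = f * u * (u : R) ^ (q - 1) * ((u⁻¹ : Rˣ) : R) ^ q := by
      have h₁ : (u : R) * (u : R) ^ (q - 1) = (u : R) ^ q := mul_pow_sub_one hq.ne' _
      rw [mul_assoc f, h₁, mul_assoc, ← mul_pow, Units.mul_inv, one_pow, mul_one]
    rw [hf]
    exact mul_mem (mul_mem (hle _ hft) (pow_mem (hle _ ht) _))
      (Subalgebra.algebraMap_mem _ (⟨_, hA _⟩ : A))⟩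
  exact Algebra.IsIntegral.finite

/-- If `R` is reduced and `A` contains a power `f ^ q` of each element, then `A`-linear
forms separate the points of `R`: for `P = Ann(s)` prime with `P ∌ x`, a linear form of the
residue field of `P` over that of `P ∩ A = Ann(s ^ q)` which does not vanish at `x` becomes a
form `R → A` when denominators are cleared. -/
theorem exists_linearForm_apply_ne_zero [IsReduced R] [Algebra.EssFiniteType k R]
    (A : Subalgebra k R) {q : ℕ} (hq : 0 < q) (hA : ∀ f : R, f ^ q ∈ A) {x : R} (hx : x ≠ 0) :
    ∃ l : R →ₗ[A] A, l x ≠ 0 := by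
  have : IsNoetherianRing R := Algebra.EssFiniteType.isNoetherianRing k R
  have : Module.Finite A R := finite_of_pow_mem A hq hA
  obtain ⟨s, P, hP, hmem, hxP⟩ := exists_prime_annihilator hx
  let p : Ideal A := P.under A
  have hp (a : A) : a ∈ p ↔ (⟨s ^ q, hA s⟩ : A) * a = 0 := by
    rw [Ideal.mem_comap, hmem, ← Subtype.val_inj]
    change s * (a : R) = 0 ↔ s ^ q * (a : R) = 0
    constructor
    · intro h
      rw [← Nat.sub_add_cancel hq, pow_succ, mul_assoc, h, mul_zero]
    · intro h
      refine IsReduced.eq_zero _ ⟨q, ?_⟩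
      rw [mul_pow, ← Nat.sub_add_cancel hq, pow_succ (a : R), mul_left_comm,
        Nat.sub_add_cancel hq, h, mul_zero]
  have hxK : algebraMap R P.ResidueField x ≠ 0 := by
    rwa [ne_eq, Ideal.algebraMap_residueField_eq_zero]
  let : Algebra p.ResidueField P.ResidueField :=
    (Ideal.ResidueField.map p P (algebraMap A R) rfl).toAlgebra
  have : IsScalarTower A p.ResidueField P.ResidueField := .of_algebraMap_eq fun a => by
    rw [RingHom.algebraMap_toAlgebra, Ideal.ResidueField.map_algebraMap,
      IsScalarTower.algebraMap_apply A R]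
  obtain ⟨φ, hφ⟩ := Module.Projective.exists_dual_ne_zero p.ResidueField hxK
  let f : R →ₗ[A] p.ResidueField :=
    (φ.restrictScalars A).comp (Algebra.linearMap R P.ResidueField |>.restrictScalars A)
  obtain ⟨t, htp, g, hg⟩ := exists_lift_residueField hp fun _ : Unit => f
  obtain ⟨r, hgr, hr⟩ := hg () x
  refine ⟨g (), ?_⟩
  rw [hgr, ne_eq, ← hp, ← Ideal.algebraMap_residueField_eq_zero, hr, Algebra.smul_def, mul_eq_zero,
    Ideal.algebraMap_residueField_eq_zero]
  exact not_or.2 ⟨htp, hφ⟩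

end LinearForms

/-! ### Positive characteristic -/

section CharP

attribute [local instance] DiffOp.ring

variable {k : Type u} [Field k] {R : Type v} [CommRing R] [Algebra k R]

/-- Let `A` contain all `q`-th powers, and let `l` be `A`-linear with values in `A`. Then
`l b l = l(b) l`, so `Φ(l) b Φ(l) = l(b) Φ(l)` for all `b ∈ R`. Evaluated at `y`, this says
`Φ(l) z = z l` for `z = Φ(l)(y)`, and a further application of `Φ` gives `z Φ(Φ(l)) = z l`. -/
theorem antiMap_antiMap_of_apply_mem [IsReduced R] {Φ : DiffOp k R ≃+* (DiffOp k R)ᵐᵒᵖ}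
    (hΦ : FixesBase Φ) {A : Subalgebra k R} {q : ℕ} (hq : 0 < q)
    (hA : ∀ f : R, f ^ q ∈ A) {l : DiffOp k R}
    (hl : ∀ a ∈ A, Commute l (mulOp k R a)) (hlA : ∀ f, l.1 f ∈ A) :
    antiMap Φ (antiMap Φ l) = l := by
  set l' := antiMap Φ l with hl'
  have hcomm (a : R) (ha : a ∈ A) : l' * mulOp k R a = mulOp k R a * l' := by
    have := congrArg (antiMap Φ) (hl a ha).eq
    rw [antiMap_mul, antiMap_mul, antiMap_mulOp hΦ] at this
    exact this.symm
  have h₁ (b : R) : l * mulOp k R b * l = mulOp k R (l.1 b) * l := by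
    refine DiffOp.ext_apply fun y => ?_
    have := congrArg (fun η : DiffOp k R => η.1 b) (hl _ (hlA y)).eq
    change l.1 (l.1 y * b) = l.1 y * l.1 b at this
    change l.1 (b * l.1 y) = l.1 b * l.1 y
    rw [mul_comm b, this, mul_comm]
  have h₂ (b : R) : l' * mulOp k R b * l' = mulOp k R (l.1 b) * l' := by
    have := congrArg (antiMap Φ) (h₁ b)
    simp only [antiMap_mul, antiMap_mulOp hΦ] at this
    rw [mul_assoc, this, hcomm _ (hlA b)]
  have h₃ (y : R) : l' * mulOp k R (l'.1 y) = mulOp k R (l'.1 y) * l := by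
    refine DiffOp.ext_apply fun b => ?_
    have := congrArg (fun η : DiffOp k R => η.1 y) (h₂ b)
    change l'.1 (b * l'.1 y) = l.1 b * l'.1 y at this
    change l'.1 (l'.1 y * b) = l'.1 y * l.1 b
    rw [mul_comm, this, mul_comm]
  have h₄ (y : R) : mulOp k R (l'.1 y) * antiMap Φ l' = mulOp k R (l'.1 y) * l := by
    have := congrArg (antiMap Φ) (h₃ y)
    rw [antiMap_mul, antiMap_mul, antiMap_mulOp hΦ, ← hl', h₃] at this
    exact this
  refine DiffOp.ext_apply fun y => sub_eq_zero.1 ?_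
  -- `x = Φ(Φ(l))(y) - l(y)` kills the image of `Φ(l)`; as `x ^ q ∈ A` commutes with `l` and `Φ(l)`,
  -- applying `Φ` and its inverse to `x ^ q Φ(l) = 0` shows that `x ^ q` kills `Φ(Φ(l))` and `l`.
  set x := (antiMap Φ l').1 y - l.1 y with hx
  have hxl' : mulOp k R (x ^ q) * l' = 0 := by
    refine DiffOp.ext_apply fun w => ?_
    have := congrArg (fun η : DiffOp k R => η.1 y) (h₄ w)
    change l'.1 w * (antiMap Φ l').1 y = l'.1 w * l.1 y at this
    change x ^ q * l'.1 w = 0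
    have hxw : x * l'.1 w = 0 := by rw [hx]; linear_combination this
    rw [← Nat.sub_add_cancel hq, pow_succ, mul_assoc, hxw, mul_zero]
  have h₅ : mulOp k R (x ^ q) * antiMap Φ l' = 0 := by
    rw [← antiMap_mulOp hΦ, ← antiMap_mul, hcomm _ (hA x), hxl', map_zero]
  have h₆ : mulOp k R (x ^ q) * l = 0 := by
    rw [← (hl _ (hA x)).eq]
    refine antiMap_injective Φ ?_
    rw [antiMap_mul, antiMap_mulOp hΦ, hxl', map_zero]
  have h₇ : x ^ q * (antiMap Φ l').1 y = 0 := congrArg (fun η : DiffOp k R => η.1 y) h₅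
  have h₈ : x ^ q * l.1 y = 0 := congrArg (fun η : DiffOp k R => η.1 y) h₆
  exact IsReduced.eq_zero x ⟨q + 1, by rw [pow_succ, hx, mul_sub, ← hx, h₇, h₈, sub_zero]⟩

/-- The positive characteristic case for reduced algebras. If `l` is an `A`-linear form, where `A`
is generated by `q`-th powers with `q` large, then `Φ ∘ Φ` fixes `l` and `l ξ`, hence
`l ∘ (Φ(Φ(ξ)) - ξ) = 0`. -/
theorem isInvolutive_of_charP {p : ℕ} [Fact p.Prime] [CharP k p] [IsReduced R]
    [Algebra.EssFiniteType k R] {Φ : DiffOp k R ≃+* (DiffOp k R)ᵐᵒᵖ} (hΦ : FixesBase Φ) :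
    IsInvolutive Φ := by
  rw [isInvolutive_iff]
  refine fun ξ => DiffOp.ext_apply fun y => sub_eq_zero.1 (of_not_not fun hy => ?_)
  obtain ⟨n, hn⟩ := exists_mem_orderLT ξ
  let q := p ^ n
  have hnq : n ≤ q := (Nat.lt_pow_self (Fact.out : p.Prime).one_lt).le
  have hq : 0 < q := pow_pos (Fact.out : p.Prime).pos n
  let A := powSubalgebra k R q
  have hA (f : R) : f ^ q ∈ A := pow_mem_powSubalgebra q f
  have hξ (a : R) (ha : a ∈ A) : Commute ξ (mulOp k R a) :=
    commute_mulOp_of_mem_powSubalgebra hnq hn ha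
  obtain ⟨l, hl⟩ := exists_linearForm_apply_ne_zero A hq hA hy
  have : Algebra.EssFiniteType A R := Algebra.EssFiniteType.of_comp k A R
  let l₁ : DiffOp k R := ⟨((Algebra.linearMap A R).comp l).restrictScalars k,
    restrictScalars_mem_diffOp (isNilpotent_one_tmul_sub A hA) _⟩
  have hl₁ (a : R) (ha : a ∈ A) : Commute l₁ (mulOp k R a) :=
    DiffOp.ext_apply fun y => congrArg Subtype.val (l.map_smul (⟨a, ha⟩ : A) y)
  have h₁ := antiMap_antiMap_of_apply_mem hΦ hq hA hl₁ fun f => (l f).2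
  have h₂ := antiMap_antiMap_of_apply_mem hΦ hq hA (l := l₁ * ξ)
    (fun a ha => (hl₁ a ha).mul_left (hξ a ha)) fun f => (l (ξ.1 f)).2
  rw [antiMap_mul, antiMap_mul, h₁] at h₂
  have h₃ := congrArg (fun η : DiffOp k R => η.1 y) h₂
  change ((l ((antiMap Φ (antiMap Φ ξ)).1 y) : A) : R) = (l (ξ.1 y) : A) at h₃
  rw [map_sub, sub_ne_zero] at hl
  exact hl (Subtype.ext h₃)

end CharP

theorem mainTheorem2 {k : Type u} [Field k] {R : Type v} [CommRing R] [Algebra k R]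
    (Φ : DiffOp k R ≃+* (DiffOp k R)ᵐᵒᵖ) (hΦ : FixesBase Φ) :
    (IsReduced R → Algebra.EssFiniteType k R → IsInvolutive Φ) ∧
    (∀ [IsLocalRing R], IsGorensteinLocalRing R → ringKrullDim R = 0 → IsCoefficientField k R →
      ∀ φ : R ≃ₗ[R] KDual k R,
        CompatibleRightModule.ofAntiAut Φ hΦ = (CompatibleRightModule.dual k R).pullback φ →
        IsInvolutive Φ) := by
  refine ⟨fun _ _ => ?_, fun _ _ _ φ h => isInvolutive_of_ofAntiAut_eq_pullback hΦ φ h⟩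
  obtain ⟨p, hp⟩ := CharP.exists k
  rcases CharP.char_is_prime_or_zero k p with hprime | rfl
  · have : Fact p.Prime := ⟨hprime⟩
    exact isInvolutive_of_charP (p := p) hΦ
  · have : CharZero k := CharP.charP_to_charZero k
    exact isInvolutive_of_charZero hΦ
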